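/- Let $n\ge 0$, and let $\mathbb{C}\mathfrak{S}_n$ be the complex vector space with basis the permutations $\mu=\mu_1\cdots\mu_n$ of $\{1,\dots,n\}$. Operators are written on the right, so $fg$ means first $f$, then $g$. For $1\le i\le n-1$ let $s_i$ be the transposition exchanging $i$ and $i+1$, let $\sigma_i\in\operatorname{End}(\mathbb{C}\mathfrak{S}_n)$ be the operator $\mu\cdot\sigma_i=\mu s_i$ (exchange of $\mu_i$ and $\mu_{i+1}$), and let $\pi_i$ be the decreasing sort operator, $\mu\cdot\pi_i=\mu$ if $\mu_i>\mu_{i+1}$ and $\mu\cdot\pi_i=\mu s_i$ otherwise. Let $\mathrm{H}\mathfrak{S}_n$ be the unital subalgebra of $\operatorname{End}(\mathbb{C}\mathfrak{S}_n)$ generated by $\sigma_1,\dots,\sigma_{n-1},\pi_1,\dots,\pi_{n-1}$. For a permutation $\sigma$ let $\operatorname{Rec}(\sigma)=\{i : \sigma^{-1}(i)>\sigma^{-1}(i+1)\}$, and set $v_\sigma=\sum_{\nu}(-1)^{\ell(\nu)}\,\nu\sigma$, the sum being over the subgroup of $\mathfrak{S}_n$ generated by the $s_i$ with $i\notin\operatorname{Rec}(\sigma)$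 and $\ell(\nu)$ being the number of inversions of $\nu$. The family $(v_\sigma)_{\sigma\in\mathfrak{S}_n}$ is a basis of $\mathbb{C}\mathfrak{S}_n$; let $p_\sigma$ be the projector on $\mathbb{C}v_\sigma$ parallel to $\bigoplus_{\tau\ne\sigma}\mathbb{C}v_\tau$. For a composition $I=(i_1,\dots,i_k)$ of $n$ let $p_I=p_\alpha$, where $\alpha$ is the shortest permutation (the one with the fewest inversions) such that $\operatorname{Rec}(\alpha)=\{i_1+\dots+i_j : 1\le j\le k-1\}$. **Theorem.** The operator $e:=\sum_{I} p_I$, where $I$ runs over all compositions of $n$, is an idempotent of $\mathrm{H}\mathfrak{S}_n$, and the algebra $e\,\mathrm{H}\mathfrak{S}_n\,e$ (with unit $e$) is isomorphic, as a $\mathbb{C}$-algebra, to the incidence algebra $\mathbb{C}[B_{n-1}]$ of the boolean lattice $B_{n-1}$ of subsets of $\{1,\dots,n-1\}$ ordered by inclusion (for $n=0$, as for $n=1$, this is the one-point lattice). Moreover $\mathrm{H}\mathfrak{S}_n$ and $\mathbb{C}[B_{n-1}]$ are Morita equivalent: their categories of right modules are equivalent as $\mathbb{C}$-linear categories, and so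 are their categories of left modules. -/

import Mathlib

/-- An algebra structure on the corner `e A e` (a ring with unit `e`) of an `R`-algebra `A`:
the scalar multiplication is the restriction of the one of `A`. -/
instance cornerModule {R A : Type*} [CommSemiring R] [Semiring A] [Algebra R A] {e : A}
    (he : IsIdempotentElem e) : Module R he.Corner where
  smul c x := ⟨c • x.1, by
    obtain ⟨r, hr⟩ := x.2
    exact ⟨c • r, by simp only [mul_smul_comm, smul_mul_assoc]; rw [← hr]⟩⟩
  one_smul x := Subtype.ext (one_smul R x.1)
  mul_smul c d x := Subtype.ext (mul_smul c d x.1)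
  smul_zero c := Subtype.ext (smul_zero (A := A) c)
  smul_add c x y := Subtype.ext (smul_add c x.1 y.1)
  add_smul c d x := Subtype.ext (add_smul c d x.1)
  zero_smul x := Subtype.ext (zero_smul R x.1)

instance cornerAlgebra {R A : Type*} [CommSemiring R] [Semiring A] [Algebra R A] {e : A}
    (he : IsIdempotentElem e) : Algebra R he.Corner :=
  Algebra.ofModule (fun c x y => Subtype.ext (smul_mul_assoc c x.1 y.1))
    (fun c x y => Subtype.ext (mul_smul_comm c x.1 y.1))

namespace HSn

open Equiv

/-- An index `i : Fin (n - 1)` stands for the element `i + 1` of `{1, …, n - 1}`; with positions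
and values numbered from `0`, it is attached to the neighbours `lo i = i` and `hi i = i + 1`. -/
def lo {n : ℕ} (i : Fin (n - 1)) : Fin n := ⟨i.1, by omega⟩

def hi {n : ℕ} (i : Fin (n - 1)) : Fin n := ⟨i.1 + 1, by omega⟩

/-- The elementary transposition `s_i`. -/
def s {n : ℕ} (i : Fin (n - 1)) : Perm (Fin n) := swap (lo i) (hi i)

/-- The vector space `ℂ𝔖_n`; the permutation `μ` is the basis vector `Pi.single μ 1`. -/
abbrev Space (n : ℕ) : Type := Perm (Fin n) → ℂ

/-- The linear extension to `ℂ𝔖_n` of a map from permutations to permutations. -/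
noncomputable def linExt {n : ℕ} (f : Perm (Fin n) → Perm (Fin n)) : Module.End ℂ (Space n) :=
  (Pi.basisFun ℂ (Perm (Fin n))).constr ℂ (fun μ => Pi.single (f μ) 1)

theorem linExt_single {n : ℕ} (f : Perm (Fin n) → Perm (Fin n)) (μ : Perm (Fin n)) :
    linExt f (Pi.single μ 1) = Pi.single (f μ) 1 := by
  rw [linExt, ← Pi.basisFun_apply, Module.Basis.constr_basis]

/-- The operator `μ ↦ μ s_i` (action on positions). -/
noncomputable def sigmaOp {n : ℕ} (i : Fin (n - 1)) : Module.End ℂ (Space n) :=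
  linExt (fun μ => μ * s i)

/-- The decreasing sort operator: `μ ↦ μ` if `μ_i > μ_{i+1}` and `μ ↦ μ s_i` otherwise. -/
noncomputable def piOp {n : ℕ} (i : Fin (n - 1)) : Module.End ℂ (Space n) :=
  linExt (fun μ => if μ (hi i) < μ (lo i) then μ else μ * s i)

/-- The algebra `H𝔖_n` generated by the `σ_i` and the `π_i`. Operators act on the right, so that
`f g` means `f` first, then `g`: the ambient algebra is the opposite of `Module.End`. -/
noncomputable def H (n : ℕ) : Subalgebra ℂ (Module.End ℂ (Space n))ᵐᵒᵖ :=
  Algebra.adjoin ℂ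
    (Set.range (fun i : Fin (n - 1) => MulOpposite.op (sigmaOp i)) ∪
      Set.range (fun i : Fin (n - 1) => MulOpposite.op (piOp i)))

/-- The descent set `{i | μ_i > μ_{i+1}}`. -/
def descents {n : ℕ} (μ : Perm (Fin n)) : Finset (Fin (n - 1)) :=
  Finset.univ.filter (fun i => μ (hi i) < μ (lo i))

/-- The recoils of `μ`: the descents of its inverse. -/
def recoils {n : ℕ} (μ : Perm (Fin n)) : Finset (Fin (n - 1)) := descents μ⁻¹

/-- The length of a permutation, as its number of inversions. -/
def len {n : ℕ} (μ : Perm (Fin n)) : ℕ :=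
  (Finset.univ.filter (fun x : Fin n × Fin n => x.1 < x.2 ∧ μ x.2 < μ x.1)).card

/-- The descent set of a composition `(k_1, …, k_p)`: the partial sums `k_1 + ⋯ + k_j`, `j < p`
(this is a bijection from compositions of `n` to subsets of `{1, …, n - 1}`). -/
def compDes {n : ℕ} (I : Composition n) : Finset (Fin (n - 1)) :=
  compositionAsSetEquiv n (compositionEquiv n I)

/-- The standard Young subgroup of the composition with descent set `S`. -/
def young {n : ℕ} (S : Finset (Fin (n - 1))) : Subgroup (Perm (Fin n)) :=
  Subgroup.closure (s '' {i | i ∉ S})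

open Classical in
/-- `v_σ = v_{Rec σ} · σ`, where `v_I = ∑_{ν ∈ 𝔖_I} (-1)^{l(ν)} ν`. -/
noncomputable def v {n : ℕ} (σ : Perm (Fin n)) : Space n :=
  ∑ ν ∈ Finset.univ.filter (fun ν : Perm (Fin n) => ν ∈ young (recoils σ)),
    Pi.single (ν * σ) ((Perm.sign ν : ℤ) : ℂ)

/-! The family `v` is a basis of `ℂ𝔖_n`, by triangularity. -/

theorem young_block {n : ℕ} {S : Finset (Fin (n - 1))} {ν : Perm (Fin n)} (h : ν ∈ young S) :
    ∀ i ∈ S, ∀ j : Fin n, (ν j).1 ≤ i.1 ↔ j.1 ≤ i.1 := by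
  intro i hi
  induction h using Subgroup.closure_induction with
  | mem x hx =>
    obtain ⟨k, hk, rfl⟩ := hx
    intro j
    have hne : k.1 ≠ i.1 := fun h => hk (by rwa [Fin.ext h])
    simp only [s, swap_apply_def, lo, HSn.hi]
    split_ifs with h1 h2
    · subst h1; simp only; omega
    · subst h2; simp only; omega
    · rfl
  | one => intro j; rfl
  | mul x y _ _ hx hy => intro j; rw [Perm.mul_apply, hx, hy]
  | inv x _ hx => intro j; rw [← hx (x⁻¹ j), ← Perm.mul_apply, mul_inv_cancel, Perm.one_apply]

theorem lt_of_block {n : ℕ} (σ : Perm (Fin n)) (j : Fin n) (m : ℕ) :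
    ∀ hm : j.1 + m + 1 < n, (∀ i ∈ recoils σ, j.1 + m + 1 ≤ i.1 ↔ j.1 ≤ i.1) →
      σ⁻¹ j < σ⁻¹ ⟨j.1 + m + 1, hm⟩ := by
  induction m with
  | zero =>
    intro hm h
    let i : Fin (n - 1) := ⟨j.1, by omega⟩
    have hi : i ∉ recoils σ := fun hi => by have := h i hi; simp [i] at this
    have hle : σ⁻¹ j ≤ σ⁻¹ ⟨j.1 + 0 + 1, hm⟩ := by
      exact not_lt.1 fun h => hi (Finset.mem_filter.2 ⟨Finset.mem_univ _, h⟩)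
    refine lt_of_le_of_ne hle fun he => ?_
    have := congrArg Fin.val (σ⁻¹.injective he)
    simp at this
  | succ m ih =>
    intro hm h
    have h1 := ih (by omega) fun i hi => by have := h i hi; omega
    let i : Fin (n - 1) := ⟨j.1 + m + 1, by omega⟩
    have hi : i ∉ recoils σ := fun hi => by have := h i hi; simp [i] at this; omega
    have hle : σ⁻¹ ⟨j.1 + m + 1, by omega⟩ ≤ σ⁻¹ ⟨j.1 + (m + 1) + 1, hm⟩ := by
      exact not_lt.1 fun h => hi (Finset.mem_filter.2 ⟨Finset.mem_univ _, h⟩)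
    exact lt_of_lt_of_le h1 hle

/-- The order in which `v` is triangular: lexicographic comparison of inverses. -/
def key {n : ℕ} (σ : Perm (Fin n)) : Lex (Fin n → Fin n) := toLex (⇑σ⁻¹)

theorem key_lt {n : ℕ} (σ ν : Perm (Fin n)) (h : ν ∈ young (recoils σ)) (hν : ν ≠ 1) :
    key σ < key (ν * σ) := by
  classical
  have hb := young_block ((young (recoils σ)).inv_mem h)
  have hne : (Finset.univ.filter (fun j : Fin n => ν⁻¹ j ≠ j)).Nonempty := by
    by_contra h0
    rw [Finset.not_nonempty_iff_eq_empty, Finset.filter_eq_empty_iff] at h0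
    apply hν
    rw [← inv_eq_one]
    ext j
    have := h0 (Finset.mem_univ j)
    rw [not_not] at this
    rw [this]; rfl
  set j := (Finset.univ.filter (fun j : Fin n => ν⁻¹ j ≠ j)).min' hne with hj
  have hj1 : ν⁻¹ j ≠ j := (Finset.mem_filter.1 (Finset.min'_mem _ hne)).2
  have hj2 : ∀ k < j, ν⁻¹ k = k := by
    intro k hk
    by_contra hk'
    exact absurd (Finset.min'_le _ k (Finset.mem_filter.2 ⟨Finset.mem_univ k, hk'⟩))
      (not_le.2 hk)
  have hlt : j < ν⁻¹ j := by
    rcases lt_trichotomy (ν⁻¹ j) j with h1 | h1 | h1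
    · exact absurd (ν⁻¹.injective (hj2 _ h1)) hj1
    · exact absurd h1 hj1
    · exact h1
  refine ⟨j, fun k hk => ?_, ?_⟩
  · change σ⁻¹ k = (ν * σ)⁻¹ k
    rw [mul_inv_rev, Perm.mul_apply, hj2 k hk]
  · change σ⁻¹ j < (ν * σ)⁻¹ j
    rw [mul_inv_rev, Perm.mul_apply]
    obtain ⟨m, hm⟩ : ∃ m, (ν⁻¹ j).1 = j.1 + m + 1 :=
      ⟨(ν⁻¹ j).1 - j.1 - 1, by have : j.1 < (ν⁻¹ j).1 := hlt; omega⟩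
    have hlt' := lt_of_block σ j m (hm ▸ (ν⁻¹ j).2) fun i hi => by rw [← hm]; exact hb i hi j
    convert hlt'

theorem v_apply_self {n : ℕ} (σ : Perm (Fin n)) : v σ σ = 1 := by
  classical
  unfold v
  rw [Finset.sum_apply, Finset.sum_eq_single 1]
  · simp
  · intro ν _ hν
    exact Pi.single_eq_of_ne (fun h => hν (by simpa using h.symm)) _
  · intro h
    exact absurd (Finset.mem_filter.2 ⟨Finset.mem_univ _, Subgroup.one_mem _⟩) h

theorem key_lt_of_v_ne_zero {n : ℕ} {σ τ : Perm (Fin n)} (h : v τ σ ≠ 0) (hne : τ ≠ σ) :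
    key τ < key σ := by
  classical
  unfold v at h
  rw [Finset.sum_apply] at h
  obtain ⟨ν, hν, h1⟩ := Finset.exists_ne_zero_of_sum_ne_zero h
  have h2 : ν * τ = σ := by
    by_contra h2
    exact h1 (Pi.single_eq_of_ne (Ne.symm h2) _)
  subst h2
  exact key_lt τ ν (Finset.mem_filter.1 hν).2 fun h => hne (by rw [h, one_mul])

theorem v_linearIndependent (n : ℕ) : LinearIndependent ℂ (v : Perm (Fin n) → Space n) := by
  classical
  rw [Fintype.linearIndependent_iff]
  intro c hc
  by_contra! hcon
  obtain ⟨σ, hσ, hmin⟩ := Finset.exists_min_image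
    (Finset.univ.filter (fun σ => c σ ≠ 0)) key
    (by obtain ⟨σ, hσ⟩ := hcon; exact ⟨σ, by simpa using hσ⟩)
  have h0 := congrFun hc σ
  rw [Finset.sum_apply, Finset.sum_eq_single σ] at h0
  · rw [Pi.smul_apply, v_apply_self] at h0
    exact (Finset.mem_filter.1 hσ).2 (by simpa using h0)
  · intro τ _ hτ
    rw [Pi.smul_apply]
    by_contra hcv
    have h1 : c τ ≠ 0 := fun h => hcv (by rw [h, zero_smul])
    have h2 : v τ σ ≠ 0 := fun h => hcv (by rw [h, smul_zero])
    exact absurd (hmin τ (Finset.mem_filter.2 ⟨Finset.mem_univ _, h1⟩))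
      (not_le.2 (key_lt_of_v_ne_zero h2 hτ))
  · intro h; exact absurd (Finset.mem_univ σ) h

/-- The family `(v_σ)` as a basis of `ℂ𝔖_n`. -/
noncomputable def vBasis (n : ℕ) : Module.Basis (Perm (Fin n)) ℂ (Space n) :=
  basisOfLinearIndependentOfCardEqFinrank (v_linearIndependent n) (by simp)

theorem vBasis_apply {n : ℕ} (σ : Perm (Fin n)) : vBasis n σ = v σ := by
  simp [vBasis]

/-- The projector `p_σ` on `ℂ v_σ` parallel to the span of the other `v_τ`. -/
noncomputable def proj {n : ℕ} (σ : Perm (Fin n)) : Module.End ℂ (Space n) :=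
  ((vBasis n).coord σ).smulRight (v σ)

theorem proj_apply_v {n : ℕ} (σ τ : Perm (Fin n)) :
    proj σ (v τ) = if τ = σ then v σ else 0 := by
  classical
  rw [proj, LinearMap.smulRight_apply, ← vBasis_apply τ, Module.Basis.coord_apply,
    Module.Basis.repr_self, Finsupp.single_apply]
  split_ifs <;> simp

/-- `α` is a permutation of minimal length among those with recoil set `S`. -/
def IsShortest {n : ℕ} (S : Finset (Fin (n - 1))) (α : Perm (Fin n)) : Prop :=
  recoils α = S ∧ ∀ β : Perm (Fin n), recoils β = S → len α ≤ len β

theorem exists_recoils_eq {n : ℕ} (S : Finset (Fin (n - 1))) :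
    ∃ α : Perm (Fin n), recoils α = S := by
  classical
  let c : ℕ → ℕ := fun j => (S.filter (fun i => j ≤ i.1)).card
  let f : Fin n → ℕ ×ₗ Fin n := fun j => toLex (c j.1, j)
  have hf : Function.Injective f := fun a b hab => congrArg (fun x => (ofLex x).2) hab
  have hmono : StrictMono (f ∘ Tuple.sort f) :=
    (Tuple.monotone_sort f).strictMono_of_injective (hf.comp (Tuple.sort f).injective)
  have hlt : ∀ a b, (Tuple.sort f)⁻¹ a < (Tuple.sort f)⁻¹ b ↔ f a < f b := by
    intro a b
    rw [← hmono.lt_iff_lt]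
    simp
  refine ⟨Tuple.sort f, ?_⟩
  ext i
  simp only [recoils, descents, Finset.mem_filter, Finset.mem_univ, true_and]
  rw [hlt, Prod.Lex.toLex_lt_toLex]
  change c (i.1 + 1) < c i.1 ∨ c (i.1 + 1) = c i.1 ∧ hi i < lo i ↔ i ∈ S
  have hnot : ¬ (hi i < lo i) := by simp [hi, lo, Fin.lt_def]
  simp only [hnot, and_false, or_false]
  constructor
  · intro h
    by_contra hiS
    refine absurd h (not_lt.2 (Finset.card_le_card fun k hk => ?_))
    rw [Finset.mem_filter] at hk ⊢
    refine ⟨hk.1, ?_⟩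
    have : i.1 ≠ k.1 := fun h => hiS (by rw [Fin.ext h]; exact hk.1)
    omega
  · intro hiS
    refine Finset.card_lt_card ⟨fun k hk => ?_, fun hsub => ?_⟩
    · rw [Finset.mem_filter] at hk ⊢
      exact ⟨hk.1, by omega⟩
    · have := (Finset.mem_filter.1 (hsub (Finset.mem_filter.2 ⟨hiS, le_refl i.1⟩))).2
      omega

theorem exists_isShortest {n : ℕ} (S : Finset (Fin (n - 1))) :
    ∃ α : Perm (Fin n), IsShortest S α := by
  classical
  obtain ⟨β, hβ⟩ := exists_recoils_eq S
  obtain ⟨α, hα, hmin⟩ := Finset.exists_min_image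
    (Finset.univ.filter (fun α : Perm (Fin n) => recoils α = S)) len ⟨β, by simpa using hβ⟩
  exact ⟨α, (Finset.mem_filter.1 hα).2, fun γ hγ => hmin γ (by simpa using hγ)⟩

/-- The shortest permutation with recoil set `S`. -/
noncomputable def shortest {n : ℕ} (S : Finset (Fin (n - 1))) : Perm (Fin n) :=
  Classical.choose (exists_isShortest S)

/-- The idempotent `p_I` of a composition: `p_α` for the shortest `α` with `Rec α = I`. -/
noncomputable def pComp {n : ℕ} (I : Composition n) : Module.End ℂ (Space n) :=
  proj (shortest (compDes I))

end HSn

/-! The algebra is determined by the subspaces it preserves. Exchanging two neighbouring values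
commutes with `sigmaOp`, and `piOp` preserves antisymmetry under this exchange
(`one_add_leftOp_mul_piOp`), so every element of `H n` stabilises each `antisymmetric S`. This space
is spanned by the `v τ` with `recoils τ ⊆ S` (`recoils_subset_of_repr_ne_zero`). In the basis `v`,
then, only matrix units v_σ ↦ v_τ with Rec τ ⊆ Rec σ can occur. Conversely the operators `sortOp`
lie in `H n`, are independent by triangularity (`sortOp_linearIndependent`), and are as numerous as
these matrix units (`card_unitIndex`). Hence `H_eq_unitSpan`.

So `H n` is the incidence algebra of a preorder, the inclusion of recoil sets. Keeping one
permutation per recoil set gives a corner which is the incidence algebra of the boolean lattice. It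
is full: each diagonal unit factors through the representative with the same recoils. A full corner
eAe is Morita equivalent to A by M ↦ eM, and passing to opposite algebras treats the other side. -/

/-! ### Full corners and Morita equivalence. -/

section FullCorner

open CategoryTheory

open scoped ModuleCat.Algebra

universe u w

/-- A realization of `B` as a full corner of `A`: a non-unital embedding of `B` onto `e A e`, where
`e` is the image of `1`, with a witness that the idempotent `e` generates `A` as an ideal. -/
structure FullCorner (R ι A B : Type*) [Fintype ι] [CommRing R] [Ring A] [Algebra R A]
    [Ring B] [Algebra R B] where
  emb : B →ₙₐ[R] A
  injective : Function.Injective emb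
  exists_emb_eq : ∀ x, ∃ b, emb b = emb 1 * x * emb 1
  left : ι → A
  right : ι → A
  sum_eq_one : ∑ i, left i * emb 1 * right i = 1

namespace FullCorner

variable {R ι : Type*} {A B : Type u} [Fintype ι] [CommRing R] [Ring A] [Algebra R A]
  [Ring B] [Algebra R B] (c : FullCorner R ι A B)

theorem emb_one_mul (b : B) : c.emb 1 * c.emb b = c.emb b := by rw [← map_mul, one_mul]

theorem emb_mul_one (b : B) : c.emb b * c.emb 1 = c.emb b := by rw [← map_mul, mul_one]

theorem isIdempotentElem : IsIdempotentElem (c.emb 1) := c.emb_one_mul 1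

/-- The opposite full corner. -/
def op : FullCorner R ι Aᵐᵒᵖ Bᵐᵒᵖ where
  emb :=
    { toFun := fun b => MulOpposite.op (c.emb b.unop)
      map_smul' := fun r b => by simp
      map_zero' := by simp
      map_add' := fun x y => by simp
      map_mul' := fun x y => by simp }
  injective := fun x y h => MulOpposite.unop_injective (c.injective (MulOpposite.op_injective h))
  exists_emb_eq := fun x => by
    obtain ⟨b, hb⟩ := c.exists_emb_eq x.unop
    refine ⟨MulOpposite.op b, MulOpposite.unop_injective ?_⟩
    change c.emb b = c.emb 1 * (x.unop * c.emb 1)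
    rw [hb, mul_assoc]
  left := fun i => MulOpposite.op (c.right i)
  right := fun i => MulOpposite.op (c.left i)
  sum_eq_one := by
    apply MulOpposite.unop_injective
    rw [Finset.unop_sum, MulOpposite.unop_one, ← c.sum_eq_one]
    refine Finset.sum_congr rfl fun i _ => ?_
    change c.left i * (c.emb 1 * c.right i) = _
    rw [mul_assoc]

/-- A full corner is isomorphic to the corner of its idempotent. -/
noncomputable def algEquivCorner {e : A} (he : IsIdempotentElem e) (h : c.emb 1 = e) :
    he.Corner ≃ₐ[R] B :=
  AlgEquiv.symm <| AlgEquiv.ofBijective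
    (AlgHom.ofLinearMap
      { toFun := fun b => (⟨c.emb b, c.emb b, by
          subst h; simp only [c.emb_one_mul, c.emb_mul_one]⟩ : he.Corner)
        map_add' := fun x y => Subtype.ext (map_add c.emb x y)
        map_smul' := fun r x => Subtype.ext (map_smul c.emb r x) }
      (Subtype.ext h) (fun x y => Subtype.ext (map_mul c.emb x y)))
    ⟨fun x y hxy => c.injective (congrArg Subtype.val hxy), fun x => by
      obtain ⟨r, hr⟩ := x.2
      obtain ⟨b, hb⟩ := c.exists_emb_eq r
      exact ⟨b, Subtype.ext (by subst h; exact hb.trans hr)⟩⟩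

section Fixed

variable (M : Type*) [AddCommGroup M] [Module A M]

/-- The part `e M` of a module. -/
def Fixed : AddSubgroup M where
  carrier := {m | c.emb 1 • m = m}
  add_mem' := fun {x y} hx hy => by
    change _ • _ = _ at hx hy
    change _ • _ = _
    rw [smul_add, hx, hy]
  zero_mem' := smul_zero _
  neg_mem' := fun {x} hx => by
    change _ • _ = _ at hx
    change _ • _ = _
    rw [smul_neg, hx]

variable {M}

theorem emb_smul_mem (b : B) (m : M) : c.emb b • m ∈ c.Fixed M := by
  change _ • _ = _
  rw [← mul_smul, c.emb_one_mul]

theorem one_smul_coe (m : c.Fixed M) : c.emb 1 • (m : M) = m := m.2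

instance fixedModule : Module B (c.Fixed M) where
  smul b m := ⟨c.emb b • m.1, c.emb_smul_mem b m.1⟩
  one_smul m := Subtype.ext m.2
  mul_smul a b m := Subtype.ext (by
    change c.emb (a * b) • m.1 = c.emb a • c.emb b • m.1
    rw [map_mul, mul_smul])
  smul_zero b := Subtype.ext (smul_zero _)
  smul_add b x y := Subtype.ext (smul_add _ _ _)
  add_smul a b m := Subtype.ext (by
    change c.emb (a + b) • m.1 = c.emb a • m.1 + c.emb b • m.1
    rw [map_add, add_smul])
  zero_smul m := Subtype.ext (by
    change c.emb 0 • m.1 = 0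
    rw [map_zero, zero_smul])

theorem coe_smul (b : B) (m : c.Fixed M) : ((b • m : c.Fixed M) : M) = c.emb b • (m : M) := rfl

variable {N : Type*} [AddCommGroup N] [Module A N]

/-- The restriction of a linear map to the parts cut out by the idempotent. -/
def mapFixed (f : M →ₗ[A] N) : c.Fixed M →ₗ[B] c.Fixed N where
  toFun m := ⟨f m, by
    change _ • _ = _
    rw [← map_smul, one_smul_coe]⟩
  map_add' x y := Subtype.ext (map_add f _ _)
  map_smul' b x := Subtype.ext (map_smul f _ _)

/-- Fullness in module form: M is generated over A by e M, so a linear map is determined by its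
values there. -/
theorem sum_smul_eq (m : M) : ∑ i, c.left i • c.emb 1 • c.right i • m = m := by
  simp_rw [← mul_smul, ← mul_assoc, ← Finset.sum_smul, c.sum_eq_one, one_smul]

theorem mapFixed_injective : Function.Injective (c.mapFixed : (M →ₗ[A] N) → _) := by
  intro f g h
  ext m
  have key : ∀ x, f (c.emb 1 • x) = g (c.emb 1 • x) := fun x =>
    congrArg Subtype.val (LinearMap.congr_fun h ⟨_, c.emb_smul_mem 1 x⟩)
  rw [← c.sum_smul_eq m, map_sum, map_sum]
  simp_rw [map_smul f (c.left _), map_smul g (c.left _), key]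

/-- The extension of a `B`-linear map on the parts cut out by the idempotent. -/
def extend (g : c.Fixed M →ₗ[B] c.Fixed N) (m : M) : N :=
  ∑ i, c.left i • (g ⟨c.emb 1 • c.right i • m, c.emb_smul_mem 1 _⟩ : N)

theorem extend_add (g : c.Fixed M →ₗ[B] c.Fixed N) (x y : M) :
    c.extend g (x + y) = c.extend g x + c.extend g y := by
  simp only [extend]
  rw [← Finset.sum_add_distrib]
  refine Finset.sum_congr rfl fun i _ => ?_
  rw [← smul_add, ← AddSubgroup.coe_add, ← map_add]
  congr 3
  exact Subtype.ext (by simp only [smul_add]; rfl)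

/-- On e M the element e (r_i x) acts as e (r_i x) e, hence as some b in B, and g commutes with b.
From this come both the A-linearity of `extend` and its agreement with g on e M. -/
theorem extend_smul_coe (g : c.Fixed M →ₗ[B] c.Fixed N) (x : A) (m : c.Fixed M) :
    c.extend g (x • (m : M)) = x • (g m : N) := by
  simp only [extend]
  rw [← c.sum_smul_eq (x • (g m : N))]
  refine Finset.sum_congr rfl fun i _ => congrArg _ ?_
  obtain ⟨b, hb⟩ := c.exists_emb_eq (c.right i * x)
  have h1 : (⟨c.emb 1 • c.right i • x • (m : M), c.emb_smul_mem 1 _⟩ : c.Fixed M) = b • m := by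
    apply Subtype.ext
    rw [coe_smul, hb, mul_smul, mul_smul, one_smul_coe, mul_smul]
  rw [h1, map_smul, coe_smul, hb, mul_smul, mul_smul, one_smul_coe, mul_smul]

theorem mapFixed_surjective : Function.Surjective (c.mapFixed : (M →ₗ[A] N) → _) := by
  intro g
  let f₀ : M →+ N :=
    { toFun := c.extend g
      map_zero' := by simpa using c.extend_add g 0 0
      map_add' := c.extend_add g }
  have h₀ : ∀ (x : A) (m : c.Fixed M), f₀ (x • (m : M)) = x • (g m : N) := c.extend_smul_coe g
  let f : M →ₗ[A] N :=
    { f₀ with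
      map_smul' := fun x m => by
        change f₀ (x • m) = x • f₀ m
        rw [← c.sum_smul_eq m, Finset.smul_sum, map_sum, map_sum, Finset.smul_sum]
        refine Finset.sum_congr rfl fun i _ => ?_
        rw [← mul_smul]
        have h := fun y => h₀ y ⟨_, c.emb_smul_mem 1 (c.right i • m)⟩
        simp only at h
        rw [h, h, mul_smul] }
  refine ⟨f, ?_⟩
  ext m
  change f₀ m = g m
  simpa using h₀ 1 m

end Fixed

/-! ### Induced modules and essential surjectivity. -/

section Induced

variable (N : Type*) [AddCommGroup N] [Module B N]

/-- The preimage of `e x e`. -/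
noncomputable def compress (x : A) : B := Classical.choose (c.exists_emb_eq x)

theorem emb_compress (x : A) : c.emb (c.compress x) = c.emb 1 * x * c.emb 1 :=
  Classical.choose_spec (c.exists_emb_eq x)

theorem compress_eq {x : A} {b : B} (h : c.emb b = c.emb 1 * x * c.emb 1) : c.compress x = b :=
  c.injective (by rw [c.emb_compress, h])

theorem compress_add (x y : A) : c.compress (x + y) = c.compress x + c.compress y :=
  c.compress_eq (by rw [map_add, c.emb_compress, c.emb_compress, mul_add, add_mul])

theorem compress_zero : c.compress 0 = 0 := c.compress_eq (by simp)

theorem compress_mul_emb (x : A) (b : B) : c.compress (x * c.emb b) = c.compress x * b :=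
  c.compress_eq (by
    rw [map_mul, c.emb_compress]
    simp only [mul_assoc, c.emb_mul_one, c.emb_one_mul])

/-- This is `sum_eq_one` inserted between x and y. It makes the matrices with entries `compress
(right i * x * left j)` multiplicative in x, and idempotent at x = 1. -/
theorem sum_compress (x y : A) :
    ∑ j, c.compress (x * c.left j) * c.compress (c.right j * y) = c.compress (x * y) := by
  symm
  apply c.compress_eq
  rw [map_sum]
  have h : x * y = ∑ j, x * (c.left j * c.emb 1 * c.right j) * y := by
    rw [← Finset.sum_mul, ← Finset.mul_sum, c.sum_eq_one, mul_one]
  rw [h, Finset.mul_sum, Finset.sum_mul]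
  refine Finset.sum_congr rfl fun j _ => ?_
  rw [map_mul, c.emb_compress, c.emb_compress]
  have := c.isIdempotentElem.eq
  simp only [mul_assoc]
  rw [← mul_assoc (c.emb 1) (c.emb 1), this]

theorem sum_compress_smul (x y : A) (n : ι → N) (i : ι) :
    ∑ j, c.compress (c.right i * x * c.left j) •
      ∑ k, c.compress (c.right j * y * c.left k) • n k =
    ∑ k, c.compress (c.right i * (x * y) * c.left k) • n k := by
  simp_rw [Finset.smul_sum]
  rw [Finset.sum_comm]
  refine Finset.sum_congr rfl fun k _ => ?_
  simp_rw [← mul_smul, ← Finset.sum_smul]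
  congr 1
  have := c.sum_compress (c.right i * x) (y * c.left k)
  simpa only [mul_assoc] using this

/-- The `A`-module induced from a `B`-module `N`, as the image of an idempotent matrix on `N^ι`. -/
def Induced : AddSubgroup (ι → N) where
  -- The factor `1` presents the idempotent as the case x = 1 of the action, so that
  -- `sum_compress_smul` applies.
  carrier := {n | ∀ i, ∑ j, c.compress (c.right i * 1 * c.left j) • n j = n i}
  add_mem' := fun {x y} hx hy i => by
    simp only [Pi.add_apply, smul_add, Finset.sum_add_distrib, hx i, hy i]
  zero_mem' := fun i => by simp
  neg_mem' := fun {x} hx i => by simp only [Pi.neg_apply, smul_neg, Finset.sum_neg_distrib, hx i]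

noncomputable instance inducedModule : Module A (c.Induced N) where
  smul x n := ⟨fun i => ∑ j, c.compress (c.right i * x * c.left j) • n.1 j, fun i => by
    rw [sum_compress_smul, one_mul]⟩
  one_smul n := Subtype.ext (funext fun i => n.2 i)
  mul_smul x y n := Subtype.ext (funext fun i => (c.sum_compress_smul N x y n.1 i).symm)
  smul_zero x := Subtype.ext (funext fun i => by
    change ∑ j, c.compress (c.right i * x * c.left j) • (0 : N) = 0
    simp)
  smul_add x m n := Subtype.ext (funext fun i => by
    change ∑ j, c.compress (c.right i * x * c.left j) • (m.1 j + n.1 j) = _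
    simp only [smul_add, Finset.sum_add_distrib]
    rfl)
  add_smul x y n := Subtype.ext (funext fun i => by
    change ∑ j, c.compress (c.right i * (x + y) * c.left j) • n.1 j = _
    simp only [mul_add, add_mul, compress_add, add_smul, Finset.sum_add_distrib]
    rfl)
  zero_smul n := Subtype.ext (funext fun i => by
    change ∑ j, c.compress (c.right i * 0 * c.left j) • n.1 j = 0
    simp [compress_zero])

theorem coe_induced_smul (x : A) (n : c.Induced N) (i : ι) :
    (x • n).1 i = ∑ j, c.compress (c.right i * x * c.left j) • n.1 j := rfl

/-- The corner of the induced module is the module one started from. -/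
noncomputable def inducedEquiv : N ≃ₗ[B] c.Fixed (c.Induced N) where
  -- The induced module is A e ⊗ N in coordinates, a ⊗ n having i-th coordinate `compress (right i *
  -- a) • n`; the image of n is e ⊗ n.
  toFun n := ⟨⟨fun i => c.compress (c.right i) • n, fun i => by
      simp_rw [← mul_smul, ← Finset.sum_smul]
      have := c.sum_compress (c.right i) 1
      simp only [mul_one] at this ⊢
      rw [this]⟩, by
    apply Subtype.ext
    funext i
    rw [coe_induced_smul]
    simp_rw [← mul_smul, ← Finset.sum_smul]
    have := c.sum_compress (c.right i * c.emb 1) 1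
    simp only [mul_one] at this
    rw [this, compress_mul_emb, mul_one]⟩
  map_add' x y := by
    apply Subtype.ext; apply Subtype.ext; funext i
    exact smul_add _ _ _
  map_smul' b n := by
    apply Subtype.ext; apply Subtype.ext; funext i
    change c.compress (c.right i) • b • n =
      ∑ j, c.compress (c.right i * c.emb b * c.left j) • c.compress (c.right j) • n
    simp_rw [← mul_smul, ← Finset.sum_smul]
    have := c.sum_compress (c.right i * c.emb b) 1
    simp only [mul_one] at this
    rw [this, compress_mul_emb]
  invFun m := ∑ j, c.compress (c.left j) • m.1.1 j
  left_inv n := by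
    change ∑ j, c.compress (c.left j) • c.compress (c.right j) • n = n
    simp_rw [← mul_smul, ← Finset.sum_smul]
    have := c.sum_compress 1 1
    simp only [mul_one, one_mul] at this
    rw [this, c.compress_eq (b := 1) (by rw [mul_one, c.emb_mul_one]), one_smul]
  right_inv m := by
    apply Subtype.ext; apply Subtype.ext; funext i
    change c.compress (c.right i) • ∑ j, c.compress (c.left j) • m.1.1 j = m.1.1 i
    have h : (c.emb 1 • m.1).1 i = m.1.1 i := congrArg (fun x => x.1 i) m.2
    rw [← h, coe_induced_smul, Finset.smul_sum]
    refine Finset.sum_congr rfl fun j _ => ?_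
    rw [← mul_smul]
    congr 1
    symm
    apply c.compress_eq
    rw [map_mul, c.emb_compress, c.emb_compress]
    have := c.isIdempotentElem.eq
    simp only [mul_assoc]
    rw [← mul_assoc (c.emb 1) (c.emb 1), this]

end Induced

/-- The functor `M ↦ e M`. -/
def functor : ModuleCat.{u} A ⥤ ModuleCat.{u} B where
  obj M := ModuleCat.of B (c.Fixed M)
  map f := ModuleCat.ofHom (c.mapFixed f.hom)

instance : c.functor.Faithful where
  map_injective {_ _ _ _} h :=
    ModuleCat.hom_ext (c.mapFixed_injective (congrArg ModuleCat.Hom.hom h))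

instance : c.functor.Full where
  map_surjective {_ _} g := by
    obtain ⟨f, hf⟩ := c.mapFixed_surjective g.hom
    exact ⟨ModuleCat.ofHom f, ModuleCat.hom_ext hf⟩

end FullCorner

namespace FullCorner

variable {R : Type*} {ι A B : Type u} [Fintype ι] [CommRing R] [Ring A] [Algebra R A]
  [Ring B] [Algebra R B] (c : FullCorner R ι A B)

instance : c.functor.EssSurj where
  mem_essImage N := ⟨ModuleCat.of A (c.Induced N), ⟨(c.inducedEquiv N).symm.toModuleIso⟩⟩

instance : c.functor.IsEquivalence where

instance : c.functor.Linear R where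
  map_smul {_ _} f r := by
    apply ModuleCat.hom_ext
    ext m
    refine Subtype.ext ?_
    -- Scalars act through r·1 in A on one side and through r·e, the image of r·1 in B, on the
    -- other; these agree on vectors fixed by e.
    change algebraMap R A r • f.hom m.1 = c.emb (algebraMap R B r) • f.hom m.1
    have h : c.emb 1 • f.hom m.1 = f.hom m.1 :=
      (map_smul f.hom _ _).symm.trans (congrArg f.hom m.2)
    rw [Algebra.algebraMap_eq_smul_one r, Algebra.algebraMap_eq_smul_one r, map_smul]
    nth_rw 1 [← h]
    rw [← mul_smul, smul_one_mul]

/-- A full corner of an algebra is Morita equivalent to the algebra. -/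
theorem isMoritaEquivalent (c : FullCorner R ι A B) : IsMoritaEquivalent R A B :=
  ⟨⟨{ eqv := c.functor.asEquivalence, linear := inferInstanceAs (c.functor.Linear R) }⟩⟩

end FullCorner

end FullCorner

namespace HSn

open Equiv

/-! ### Left and right sorting of permutations. -/

section Combinatorics

variable {n : ℕ}

theorem apply_inv_apply (μ : Perm (Fin n)) (x : Fin n) : μ (μ⁻¹ x) = x := μ.apply_symm_apply x

theorem inv_apply_apply (μ : Perm (Fin n)) (x : Fin n) : μ⁻¹ (μ x) = x := μ.symm_apply_apply x

theorem lo_lt_hi (i : Fin (n - 1)) : lo i < hi i := Nat.lt_succ_self i.1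

theorem s_lo (i : Fin (n - 1)) : s i (lo i) = hi i := swap_apply_left _ _

theorem s_hi (i : Fin (n - 1)) : s i (hi i) = lo i := swap_apply_right _ _

theorem s_mul_self (i : Fin (n - 1)) : s i * s i = 1 := swap_mul_self _ _

theorem s_inv (i : Fin (n - 1)) : (s i)⁻¹ = s i := swap_inv _ _

theorem s_ne_one (i : Fin (n - 1)) : s i ≠ 1 := fun h =>
  (lo_lt_hi i).ne' (by rw [← s_lo, h, Perm.one_apply])

theorem mem_descents {i : Fin (n - 1)} {μ : Perm (Fin n)} :
    i ∈ descents μ ↔ μ (hi i) < μ (lo i) := by simp [descents]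

theorem mem_recoils {i : Fin (n - 1)} {μ : Perm (Fin n)} :
    i ∈ recoils μ ↔ μ⁻¹ (hi i) < μ⁻¹ (lo i) := mem_descents

theorem recoils_inv (μ : Perm (Fin n)) : recoils μ⁻¹ = descents μ := by rw [recoils, inv_inv]

theorem mem_recoils_s_mul {i : Fin (n - 1)} {μ : Perm (Fin n)} :
    i ∈ recoils (s i * μ) ↔ i ∉ recoils μ := by
  rw [mem_recoils, mem_recoils, mul_inv_rev, s_inv, Perm.mul_apply, Perm.mul_apply, s_lo, s_hi,
    not_lt]
  exact ⟨le_of_lt, fun h => h.lt_of_ne fun h' => (lo_lt_hi i).ne (μ⁻¹.injective h')⟩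

theorem mem_descents_mul_s {i : Fin (n - 1)} {μ : Perm (Fin n)} :
    i ∈ descents (μ * s i) ↔ i ∉ descents μ := by
  rw [← recoils_inv, ← recoils_inv, mul_inv_rev, s_inv, mem_recoils_s_mul]

theorem s_mem_young {S : Finset (Fin (n - 1))} {i : Fin (n - 1)} (h : i ∉ S) : s i ∈ young S :=
  Subgroup.subset_closure ⟨i, h, rfl⟩

theorem young_anti {S T : Finset (Fin (n - 1))} (h : S ⊆ T) : young T ≤ young S :=
  Subgroup.closure_mono (Set.image_mono fun _ hi hS => hi (h hS))

theorem key_injective : Function.Injective (key : Perm (Fin n) → _) := fun _ _ h =>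
  inv_injective (DFunLike.coe_injective (toLex.injective h))

theorem key_lt_s_mul {i : Fin (n - 1)} {μ : Perm (Fin n)} (h : i ∉ recoils μ) :
    key μ < key (s i * μ) := key_lt μ (s i) (s_mem_young h) (s_ne_one i)

/-- The inverse is strictly increasing, and a finite chain has no order automorphism but the
identity. -/
theorem eq_one_of_recoils_eq_empty {μ : Perm (Fin n)} (h : recoils μ = ∅) : μ = 1 := by
  have hm : StrictMono ⇑(μ⁻¹) := fun a b hab => by
    obtain ⟨m, hm⟩ : ∃ m, b.1 = a.1 + m + 1 := ⟨b.1 - a.1 - 1, by have : a.1 < b.1 := hab; omega⟩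
    rw [show b = ⟨a.1 + m + 1, hm ▸ b.2⟩ from Fin.ext hm]
    exact lt_of_block μ a m _ (by simp [h])
  have h1 : hm.orderIsoOfSurjective _ (μ⁻¹).surjective = OrderIso.refl _ := Subsingleton.elim _ _
  rw [← inv_eq_one]
  ext x
  exact congrArg Fin.val (DFunLike.congr_fun h1 x)

/-- Induction along the left weak order. -/
theorem left_induction {P : Perm (Fin n) → Prop} (one : P 1)
    (step : ∀ μ i, i ∉ recoils μ → P μ → P (s i * μ)) (μ : Perm (Fin n)) : P μ := by
  induction μ using (InvImage.wf key (wellFounded_lt (α := Lex (Fin n → Fin n)))).induction with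
  | _ μ ih =>
    obtain h | ⟨i, hi⟩ := (recoils μ).eq_empty_or_nonempty
    · rwa [eq_one_of_recoils_eq_empty h]
    · have h2 : s i * (s i * μ) = μ := by rw [← mul_assoc, s_mul_self, one_mul]
      have h1 : i ∉ recoils (s i * μ) := fun h => mem_recoils_s_mul.1 h hi
      have h3 := key_lt_s_mul h1
      rw [h2] at h3
      have := step _ i h1 (ih _ h3)
      rwa [h2] at this

/-- The decreasing sort of the positions of the values `i` and `i + 1`. -/
def leftSort (i : Fin (n - 1)) (μ : Perm (Fin n)) : Perm (Fin n) :=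
  if i ∈ recoils μ then μ else s i * μ

/-- The decreasing sort of the values at the positions `i` and `i + 1`. -/
def rightSort (i : Fin (n - 1)) (μ : Perm (Fin n)) : Perm (Fin n) :=
  if i ∈ descents μ then μ else μ * s i

theorem key_le_leftSort (i : Fin (n - 1)) (μ : Perm (Fin n)) : key μ ≤ key (leftSort i μ) := by
  unfold leftSort
  split_ifs with h
  exacts [le_rfl, (key_lt_s_mul h).le]

theorem s_lt_s_iff {j : Fin (n - 1)} {a b : Fin n} (h1 : ¬(a = lo j ∧ b = hi j))
    (h2 : ¬(a = hi j ∧ b = lo j)) : s j a < s j b ↔ a < b := by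
  simp only [s, swap_apply_def]
  simp only [Fin.ext_iff, lo, hi] at h1 h2 ⊢
  split_ifs <;> simp only [Fin.lt_def] <;> omega

/-- Exchanging the positions j, j + 1 alters the relative order of the values i, i + 1 only if they
occupy exactly these positions, that is, if `s i * μ = μ * s j`. -/
theorem mem_recoils_mul_s {i j : Fin (n - 1)} {μ : Perm (Fin n)} (h : s i * μ ≠ μ * s j) :
    i ∈ recoils (μ * s j) ↔ i ∈ recoils μ := by
  rw [mem_recoils, mem_recoils, mul_inv_rev, s_inv, Perm.mul_apply, Perm.mul_apply]
  refine s_lt_s_iff (fun h' => h ?_) (fun h' => h ?_)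
  · rw [s, s, mul_swap_eq_swap_mul, ← h'.1, ← h'.2, apply_inv_apply, apply_inv_apply,
      swap_comm]
  · rw [s, s, mul_swap_eq_swap_mul, ← h'.1, ← h'.2, apply_inv_apply, apply_inv_apply]

theorem mem_descents_s_mul {i j : Fin (n - 1)} {μ : Perm (Fin n)} (h : s i * μ ≠ μ * s j) :
    j ∈ descents (s i * μ) ↔ j ∈ descents μ := by
  rw [← recoils_inv, ← recoils_inv, mul_inv_rev, s_inv]
  refine mem_recoils_mul_s fun h' => h ?_
  have := congrArg (fun x => x⁻¹) h'
  simpa [s_inv] using this.symm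

theorem mem_recoils_iff_mem_descents {i j : Fin (n - 1)} {μ : Perm (Fin n)}
    (h : s i * μ = μ * s j) : i ∈ recoils μ ↔ j ∈ descents μ := by
  have h1 : s i (μ (lo j)) = μ (hi j) := by
    rw [← Perm.mul_apply, h, Perm.mul_apply, s_lo]
  have h2 : μ (hi j) ≠ μ (lo j) := fun h' => (lo_lt_hi j).ne' (μ.injective h')
  rw [mem_recoils, mem_descents]
  by_cases h3 : μ (lo j) = lo i
  · rw [h3, s_lo] at h1
    rw [← h1, ← h3, inv_apply_apply, h3, h1, inv_apply_apply, ← h1]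
    exact iff_of_false (lo_lt_hi j).not_gt (lo_lt_hi i).not_gt
  · by_cases h4 : μ (lo j) = hi i
    · rw [h4, s_hi] at h1
      rw [← h1, ← h4, inv_apply_apply, h4, h1, inv_apply_apply, ← h1]
      exact iff_of_true (lo_lt_hi j) (lo_lt_hi i)
    · exact absurd (h1.symm.trans (swap_apply_of_ne_of_ne h3 h4)) h2

/-- If `s i * μ = μ * s j`, both sorts handle the same pair and either composite leaves it
decreasing. Otherwise neither sort affects the test made by the other. -/
theorem leftSort_rightSort (i j : Fin (n - 1)) (μ : Perm (Fin n)) :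
    leftSort i (rightSort j μ) = rightSort j (leftSort i μ) := by
  unfold leftSort rightSort
  by_cases h : s i * μ = μ * s j
  · have h1 := mem_recoils_iff_mem_descents h
    by_cases h2 : i ∈ recoils μ
    · rw [if_pos h2, if_pos (h1.1 h2), if_pos h2]
    · rw [if_neg h2, if_neg (h1.not.1 h2), ← h, if_pos (mem_recoils_s_mul.2 h2), h,
        if_pos (mem_descents_mul_s.2 (h1.not.1 h2))]
  · have h1 := mem_recoils_mul_s h
    have h2 := mem_descents_s_mul h
    by_cases h3 : i ∈ recoils μ <;> by_cases h4 : j ∈ descents μ <;>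
      simp [h1, h2, h3, h4, mul_assoc]

/-- Minimal coset representatives are unique. -/
theorem eq_of_inv_mul_mem_young {σ τ : Perm (Fin n)} {J : Finset (Fin (n - 1))}
    (hσ : Disjoint (descents σ) J) (hτ : Disjoint (descents τ) J) (h : τ⁻¹ * σ ∈ young Jᶜ) :
    σ = τ := by
  -- Left multiplication by τ⁻¹σ takes σ⁻¹ to τ⁻¹, so `key_lt` compares the two; exchanging the
  -- roles gives the opposite strict inequality.
  have key_lt_of : ∀ {σ τ : Perm (Fin n)}, Disjoint (descents σ) J → τ⁻¹ * σ ∈ young Jᶜ →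
      τ⁻¹ * σ ≠ 1 → key σ⁻¹ < key τ⁻¹ := fun {σ τ} hd hm hne => by
    have := key_lt σ⁻¹ (τ⁻¹ * σ) (young_anti (by
      rw [recoils_inv]; exact Finset.subset_compl_iff_disjoint_right.2 hd) hm) hne
    rwa [mul_inv_cancel_right] at this
  by_contra hne
  have h1 : τ⁻¹ * σ ≠ 1 := fun h' => hne (inv_mul_eq_one.1 h').symm
  have h2 : σ⁻¹ * τ ≠ 1 := fun h' => hne (inv_mul_eq_one.1 h')
  have h' : σ⁻¹ * τ ∈ young Jᶜ := by
    have := (young Jᶜ).inv_mem h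
    rwa [mul_inv_rev, inv_inv] at this
  exact lt_asymm (key_lt_of hσ h h1) (key_lt_of hτ h' h2)

end Combinatorics

/-! ### Independent elements of the algebra: the lower bound on its dimension. -/

section Operators

variable {n : ℕ}

theorem end_ext {f g : Module.End ℂ (Space n)}
    (h : ∀ μ : Perm (Fin n), f (Pi.single μ 1) = g (Pi.single μ 1)) : f = g :=
  (Pi.basisFun ℂ (Perm (Fin n))).ext fun μ => by rw [Pi.basisFun_apply, h]

theorem linExt_mul (f g : Perm (Fin n) → Perm (Fin n)) :
    linExt f * linExt g = linExt (f ∘ g) :=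
  end_ext fun μ => by simp only [Module.End.mul_apply, linExt_single, Function.comp]

theorem linExt_id : linExt (fun μ : Perm (Fin n) => μ) = 1 :=
  end_ext fun μ => by rw [linExt_single, Module.End.one_apply]

theorem piOp_eq (i : Fin (n - 1)) : piOp i = linExt (rightSort i) := by
  unfold piOp rightSort
  simp only [mem_descents]

theorem op_linExt_comp_mem {f g : Perm (Fin n) → Perm (Fin n)}
    (hf : MulOpposite.op (linExt f) ∈ H n) (hg : MulOpposite.op (linExt g) ∈ H n) :
    MulOpposite.op (linExt (f ∘ g)) ∈ H n := by
  rw [← linExt_mul, MulOpposite.op_mul]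
  exact mul_mem hg hf

theorem op_sigmaOp_mem (i : Fin (n - 1)) : MulOpposite.op (sigmaOp i) ∈ H n :=
  Algebra.subset_adjoin (Or.inl ⟨i, rfl⟩)

theorem op_piOp_mem (i : Fin (n - 1)) : MulOpposite.op (piOp i) ∈ H n :=
  Algebra.subset_adjoin (Or.inr ⟨i, rfl⟩)

theorem op_linExt_mul_right_mem (σ : Perm (Fin n)) :
    MulOpposite.op (linExt (fun μ => μ * σ)) ∈ H n := by
  induction σ using left_induction with
  | one =>
    simp only [mul_one, linExt_id]
    exact one_mem _
  | step σ i _ ih =>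
    have := op_linExt_comp_mem ih (op_sigmaOp_mem i)
    simpa only [Function.comp_def, mul_assoc] using this

/-- The operators `π_τ`, by their effect on permutations. -/
theorem exists_sorter (τ : Perm (Fin n)) : ∃ d : Perm (Fin n) → Perm (Fin n),
    MulOpposite.op (linExt d) ∈ H n ∧ (∀ i μ, leftSort i (d μ) = d (leftSort i μ)) ∧ d 1 = τ := by
  -- The map is a composite of right sorts along a reduced word of τ. The word grows on the right of
  -- τ, hence the induction on the inverse.
  rw [← inv_inv τ]
  induction τ⁻¹ using left_induction with
  | one =>
    exact ⟨fun μ => μ, by rw [linExt_id]; exact one_mem _, fun _ _ => rfl, by simp⟩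
  | step τ i hi ih =>
    obtain ⟨d, hd, hc, h1⟩ := ih
    refine ⟨rightSort i ∘ d, op_linExt_comp_mem (by rw [← piOp_eq]; exact op_piOp_mem i) hd,
      fun j μ => ?_, ?_⟩
    · rw [Function.comp_apply, leftSort_rightSort, hc, Function.comp_apply]
    · rw [Function.comp_apply, h1, rightSort, ← recoils_inv, inv_inv, if_neg hi, mul_inv_rev, s_inv]

/-- The map underlying the operator `π_τ`. -/
noncomputable def sorter (τ : Perm (Fin n)) : Perm (Fin n) → Perm (Fin n) :=
  Classical.choose (exists_sorter τ)

theorem op_linExt_sorter_mem (τ : Perm (Fin n)) : MulOpposite.op (linExt (sorter τ)) ∈ H n :=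
  (Classical.choose_spec (exists_sorter τ)).1

theorem leftSort_sorter (τ : Perm (Fin n)) (i : Fin (n - 1)) (μ : Perm (Fin n)) :
    leftSort i (sorter τ μ) = sorter τ (leftSort i μ) :=
  (Classical.choose_spec (exists_sorter τ)).2.1 i μ

theorem sorter_one (τ : Perm (Fin n)) : sorter τ 1 = τ :=
  (Classical.choose_spec (exists_sorter τ)).2.2

/-- Iterated along a reduced word of μ, this computes `sorter τ μ` from `sorter τ 1 = τ` by left
sorts alone. -/
theorem sorter_s_mul (τ : Perm (Fin n)) {i : Fin (n - 1)} {μ : Perm (Fin n)} (h : i ∉ recoils μ) :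
    sorter τ (s i * μ) = leftSort i (sorter τ μ) := by
  rw [leftSort_sorter, leftSort, if_neg h]

theorem key_le_sorter (τ μ : Perm (Fin n)) : key τ ≤ key (sorter τ μ) := by
  induction μ using left_induction with
  | one => rw [sorter_one]
  | step μ i hi ih =>
    rw [sorter_s_mul τ hi]
    exact ih.trans (key_le_leftSort _ _)

/-- Left sorts never lower `key`, so returning to τ forces each of them to be idle: all the letters
met are recoils of τ, and their transpositions generate this subgroup. -/
theorem mem_young_of_sorter_eq {τ μ : Perm (Fin n)} (h : sorter τ μ = τ) :
    μ ∈ young (recoils τ)ᶜ := by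
  induction μ using left_induction with
  | one => exact one_mem _
  | step μ i hi ih =>
    rw [sorter_s_mul τ hi] at h
    have h1 : sorter τ μ = τ := key_injective <| le_antisymm
      ((key_le_leftSort i _).trans (by rw [h])) (key_le_sorter τ μ)
    refine mul_mem (s_mem_young fun hi' => ?_) (ih h1)
    rw [Finset.mem_compl] at hi'
    rw [h1, leftSort, if_neg hi'] at h
    exact s_ne_one i (mul_eq_right.1 h)

/-- The operators `σ π_τ` with no descent of `σ` being a recoil of `τ`. -/
noncomputable def sortOp
    (p : {p : Perm (Fin n) × Perm (Fin n) // Disjoint (descents p.1) (recoils p.2)}) :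
    Module.End ℂ (Space n) :=
  linExt (sorter p.1.2 ∘ fun μ => μ * p.1.1)

theorem op_sortOp_mem
    (p : {p : Perm (Fin n) × Perm (Fin n) // Disjoint (descents p.1) (recoils p.2)}) :
    MulOpposite.op (sortOp p) ∈ H n :=
  op_linExt_comp_mem (op_linExt_sorter_mem _) (op_linExt_mul_right_mem _)

/-- Among the pairs with nonzero coefficient take (σ, τ) with `key τ` minimal, and read the
coefficient of τ in the image of σ⁻¹. A pair (σ', τ') contributes only if `key τ' ≤ key τ`, so τ' =
τ; then σ and σ' lie in one coset, of which both are the minimal representative. -/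
theorem sortOp_linearIndependent : LinearIndependent ℂ (sortOp (n := n)) := by
  classical
  rw [Fintype.linearIndependent_iff]
  intro c hc
  by_contra! hcon
  obtain ⟨p, hp, hmin⟩ := Finset.exists_min_image (Finset.univ.filter (fun p => c p ≠ 0))
    (fun p => key p.1.2) (by obtain ⟨p, hp⟩ := hcon; exact ⟨p, by simpa using hp⟩)
  have hval : ∀ q, sortOp q (Pi.single p.1.1⁻¹ 1) p.1.2 =
      if p.1.2 = sorter q.1.2 (p.1.1⁻¹ * q.1.1) then 1 else 0 := fun q => by
    rw [sortOp, linExt_single, Pi.single_apply, Function.comp_apply]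
  have h0 := congrFun (LinearMap.congr_fun hc (Pi.single p.1.1⁻¹ 1)) p.1.2
  rw [LinearMap.sum_apply, Finset.sum_apply, Finset.sum_eq_single p] at h0
  · rw [LinearMap.smul_apply, Pi.smul_apply, hval, inv_mul_cancel, sorter_one, if_pos rfl] at h0
    exact (Finset.mem_filter.1 hp).2 (by simpa using h0)
  · intro q _ hq
    rw [LinearMap.smul_apply, Pi.smul_apply, hval]
    split_ifs with h
    · by_contra hne
      have hcq : c q ≠ 0 := fun h => hne (by rw [h, zero_smul])
      have h1 := hmin q (Finset.mem_filter.2 ⟨Finset.mem_univ _, hcq⟩)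
      have h2 := key_le_sorter q.1.2 (p.1.1⁻¹ * q.1.1)
      rw [← h] at h2
      have h3 : q.1.2 = p.1.2 := key_injective (le_antisymm h2 h1)
      rw [h3] at h
      have hq2 := q.2
      rw [h3] at hq2
      exact hq (Subtype.ext (Prod.ext
        (eq_of_inv_mul_mem_young hq2 p.2 (mem_young_of_sorter_eq h.symm)) h3))
    · rw [smul_zero]
  · intro h; exact absurd (Finset.mem_univ p) h

end Operators

end HSn

namespace HSn

open Equiv

/-! ### Invariant subspaces: the upper bound on the algebra. -/

section Antisymmetric

variable {n : ℕ}

/-- The action of `s_i` on values. -/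
noncomputable def leftOp (i : Fin (n - 1)) : Module.End ℂ (Space n) := linExt (fun μ => s i * μ)

theorem leftOp_apply (i : Fin (n - 1)) (x : Space n) (μ : Perm (Fin n)) :
    leftOp i x μ = x (s i * μ) := by
  have h : leftOp i = LinearMap.funLeft ℂ ℂ (fun μ => s i * μ) := end_ext fun ρ => by
    ext μ
    rw [leftOp, linExt_single, LinearMap.funLeft_apply, Pi.single_apply, Pi.single_apply]
    refine if_congr ?_ rfl rfl
    rw [← inv_mul_eq_iff_eq_mul, s_inv]
  rw [h, LinearMap.funLeft_apply]

/-- The vectors that are antisymmetric under `s_i`, acting on values, for each `i ∉ S`. -/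
noncomputable def antisymmetric (S : Finset (Fin (n - 1))) : Submodule ℂ (Space n) where
  carrier := {x | ∀ i ∉ S, leftOp i x = -x}
  add_mem' := fun hx hy i hi => by rw [map_add, hx i hi, hy i hi, neg_add]
  zero_mem' := fun i _ => by rw [map_zero, neg_zero]
  smul_mem' := fun c x hx i hi => by rw [map_smul, hx i hi, smul_neg]

theorem antisymmetric_mono {S T : Finset (Fin (n - 1))} (h : S ⊆ T) :
    antisymmetric S ≤ antisymmetric T := fun _ hx i hi => hx i fun hS => hi (h hS)

open Classical in
theorem v_apply (σ ρ : Perm (Fin n)) :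
    v σ ρ = if ρ * σ⁻¹ ∈ young (recoils σ) then ((Perm.sign (ρ * σ⁻¹) : ℤ) : ℂ) else 0 := by
  have h : ∀ ν : Perm (Fin n), (Pi.single (ν * σ) ((Perm.sign ν : ℤ) : ℂ) : Space n) ρ =
      if ρ * σ⁻¹ = ν then ((Perm.sign ν : ℤ) : ℂ) else 0 := fun ν => by
    rw [Pi.single_apply]
    exact if_congr mul_inv_eq_iff_eq_mul.symm rfl rfl
  rw [v, Finset.sum_apply, Finset.sum_congr rfl fun ν _ => h ν, Finset.sum_ite_eq]
  simp

theorem sign_s_mul (i : Fin (n - 1)) (μ : Perm (Fin n)) :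
    Perm.sign (s i * μ) = -Perm.sign μ := by
  rw [Perm.sign_mul, s, Perm.sign_swap (lo_lt_hi i).ne, neg_one_mul]

theorem v_mem_antisymmetric (σ : Perm (Fin n)) : v σ ∈ antisymmetric (recoils σ) := by
  intro i hi
  ext ρ
  rw [leftOp_apply, Pi.neg_apply, v_apply, v_apply, mul_assoc,
    Subgroup.mul_mem_cancel_left _ (s_mem_young hi), sign_s_mul]
  split_ifs <;> simp

/-- Remove from x its components with recoils inside S, which are antisymmetric already. If the
remainder y is nonzero, let σ have minimal `key` in its expansion and pick a recoil i of σ outside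
S. By triangularity y is nonzero at σ and zero at `s i * σ`, which has smaller `key`; this
contradicts antisymmetry under `s i`. -/
theorem recoils_subset_of_repr_ne_zero {S : Finset (Fin (n - 1))} {x : Space n}
    (hx : x ∈ antisymmetric S) {τ : Perm (Fin n)} (h : (vBasis n).repr x τ ≠ 0) :
    recoils τ ⊆ S := by
  classical
  by_contra hτ
  set c := (vBasis n).repr x
  set good := Finset.univ.filter fun σ : Perm (Fin n) => recoils σ ⊆ S
  set bad := Finset.univ.filter fun σ : Perm (Fin n) => ¬recoils σ ⊆ S
  set y := ∑ σ ∈ bad, c σ • v σ with hy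
  have hxy : ∑ σ ∈ good, c σ • v σ + y = x := by
    rw [hy, Finset.sum_filter_add_sum_filter_not]
    simpa only [vBasis_apply] using (vBasis n).sum_repr x
  have hyS : y ∈ antisymmetric S := by
    rw [← eq_sub_iff_add_eq'] at hxy
    rw [hxy]
    exact sub_mem hx (sum_mem fun σ hσ => Submodule.smul_mem _ _
      (antisymmetric_mono (Finset.mem_filter.1 hσ).2 (v_mem_antisymmetric σ)))
  obtain ⟨σ, hσ, hmin⟩ := Finset.exists_min_image (bad.filter (fun σ => c σ ≠ 0)) key
    ⟨τ, Finset.mem_filter.2 ⟨Finset.mem_filter.2 ⟨Finset.mem_univ _, hτ⟩, h⟩⟩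
  obtain ⟨hσb, hσ0⟩ := Finset.mem_filter.1 hσ
  have hval : ∀ ρ ρ', key ρ ≤ key σ → ρ' ∈ bad → ρ' ≠ ρ → (c ρ' • v ρ') ρ = 0 := by
    intro ρ ρ' hρ hρ' hne
    rw [Pi.smul_apply]
    by_contra hcv
    have h1 : c ρ' ≠ 0 := fun h => hcv (by rw [h, zero_smul])
    have h2 : v ρ' ρ ≠ 0 := fun h => hcv (by rw [h, smul_zero])
    exact absurd ((hmin ρ' (Finset.mem_filter.2 ⟨hρ', h1⟩)).trans_lt (key_lt_of_v_ne_zero h2 hne))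
      (not_lt.2 hρ)
  have h1 : y σ ≠ 0 := by
    rw [hy, Finset.sum_apply, Finset.sum_eq_single_of_mem σ hσb
      fun ρ' hρ' hne => hval σ ρ' le_rfl hρ' hne, Pi.smul_apply, v_apply_self]
    simpa using hσ0
  obtain ⟨i, hiσ, hiS⟩ := Finset.not_subset.1 (Finset.mem_filter.1 hσb).2
  have h2 : s i * (s i * σ) = σ := by rw [← mul_assoc, s_mul_self, one_mul]
  have hlt : key (s i * σ) < key σ := by
    have := key_lt_s_mul (i := i) (μ := s i * σ) fun h => mem_recoils_s_mul.1 h hiσ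
    rwa [h2] at this
  have h3 : y (s i * σ) = 0 := by
    rw [hy, Finset.sum_apply]
    refine Finset.sum_eq_zero fun ρ hρ => ?_
    by_cases hne : ρ = s i * σ
    · have : c ρ = 0 := by
        by_contra h0
        exact absurd (hmin ρ (Finset.mem_filter.2 ⟨hρ, h0⟩)) (not_le.2 (hne ▸ hlt))
      rw [this, zero_smul, Pi.zero_apply]
    · exact hval _ ρ hlt.le hρ hne
  have h4 := congrFun (hyS i hiS) σ
  rw [leftOp_apply, h3, Pi.neg_apply] at h4
  exact h1 (neg_eq_zero.1 h4.symm)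

theorem rightSort_s_mul (i j : Fin (n - 1)) (μ : Perm (Fin n)) :
    rightSort j (s i * μ) = rightSort j μ ∨ rightSort j (s i * μ) = s i * rightSort j μ := by
  unfold rightSort
  by_cases h : s i * μ = μ * s j
  · left
    rw [h]
    by_cases h1 : j ∈ descents μ
    · rw [if_neg fun h' => mem_descents_mul_s.1 h' h1, if_pos h1, mul_assoc, s_mul_self, mul_one]
    · rw [if_pos (mem_descents_mul_s.2 h1), if_neg h1]
  · right
    simp only [mem_descents_s_mul h]
    split_ifs
    · rfl
    · rw [mul_assoc]

/-- On the pair μ, `s i * μ`, the sort either merges the two, killing their difference, or commutes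
with the exchange, and (1 + L)(1 - L) = 0 for an involution L. -/
theorem one_add_leftOp_mul_piOp (i j : Fin (n - 1)) :
    (1 + leftOp i) * (piOp j * (1 - leftOp i)) = 0 := by
  refine end_ext fun μ => ?_
  rw [piOp_eq, leftOp]
  simp only [Module.End.mul_apply, LinearMap.add_apply, LinearMap.sub_apply, Module.End.one_apply,
    linExt_single, map_sub, LinearMap.zero_apply]
  rcases rightSort_s_mul i j μ with h | h
  · rw [h, sub_self]
  · rw [h, ← mul_assoc, s_mul_self, one_mul]
    abel

theorem piOp_mem_antisymmetric (j : Fin (n - 1)) {S : Finset (Fin (n - 1))} {x : Space n}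
    (hx : x ∈ antisymmetric S) : piOp j x ∈ antisymmetric S := by
  intro i hi
  have h := LinearMap.congr_fun (one_add_leftOp_mul_piOp i j) x
  simp only [Module.End.mul_apply, LinearMap.add_apply, LinearMap.sub_apply, Module.End.one_apply,
    hx i hi, sub_neg_eq_add, LinearMap.zero_apply, map_add] at h
  -- On antisymmetric vectors 1 - L is multiplication by 2, which can be divided out.
  have h2 : (2 : ℂ) • (piOp j x + leftOp i (piOp j x)) = 0 := by
    rw [two_smul, ← h]
  rw [smul_eq_zero_iff_right two_ne_zero] at h2
  exact eq_neg_of_add_eq_zero_right h2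

theorem sigmaOp_mem_antisymmetric (j : Fin (n - 1)) {S : Finset (Fin (n - 1))} {x : Space n}
    (hx : x ∈ antisymmetric S) : sigmaOp j x ∈ antisymmetric S := by
  intro i hi
  have h : leftOp i * sigmaOp j = sigmaOp j * leftOp i := by
    rw [leftOp, sigmaOp, linExt_mul, linExt_mul]
    simp only [Function.comp_def, mul_assoc]
  rw [← Module.End.mul_apply, h, Module.End.mul_apply, hx i hi, map_neg]

theorem unop_mem_antisymmetric {f : (Module.End ℂ (Space n))ᵐᵒᵖ} (hf : f ∈ H n)
    {S : Finset (Fin (n - 1))} {x : Space n} (hx : x ∈ antisymmetric S) :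
    f.unop x ∈ antisymmetric S := by
  induction hf using Algebra.adjoin_induction generalizing x with
  | mem f hf =>
    obtain ⟨j, rfl⟩ | ⟨j, rfl⟩ := hf
    · exact sigmaOp_mem_antisymmetric j hx
    · exact piOp_mem_antisymmetric j hx
  | algebraMap c => exact Submodule.smul_mem _ c hx
  | add f g _ _ hf hg => exact add_mem (hf hx) (hg hx)
  | mul f g _ _ hf hg => exact hg (hf hx)

end Antisymmetric

/-! ### The algebra as a span of matrix units. -/

section MatrixUnits

variable {n : ℕ}

/-- The matrix units of the basis `v`. -/
noncomputable def matrixUnit (σ τ : Perm (Fin n)) : Module.End ℂ (Space n) :=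
  ((vBasis n).coord σ).smulRight (v τ)

theorem matrixUnit_apply (σ τ : Perm (Fin n)) (x : Space n) :
    matrixUnit σ τ x = (vBasis n).repr x σ • v τ := rfl

theorem repr_v (σ : Perm (Fin n)) : (vBasis n).repr (v σ) = Finsupp.single σ 1 := by
  rw [← vBasis_apply, Module.Basis.repr_self]

theorem eq_sum_matrixUnit (f : Module.End ℂ (Space n)) :
    f = ∑ σ, ∑ τ, (vBasis n).repr (f (v σ)) τ • matrixUnit σ τ := by
  classical
  refine (vBasis n).ext fun ρ => ?_
  rw [vBasis_apply]
  simp only [LinearMap.sum_apply, LinearMap.smul_apply, matrixUnit_apply, repr_v]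
  rw [Finset.sum_eq_single ρ]
  · simp only [Finsupp.single_eq_same, one_smul]
    simpa only [vBasis_apply] using ((vBasis n).sum_repr (f (v ρ))).symm
  · intro σ _ hσ
    simp [Finsupp.single_eq_of_ne hσ]
  · simp

theorem recoils_subset_of_mem {f : (Module.End ℂ (Space n))ᵐᵒᵖ} (hf : f ∈ H n)
    {σ τ : Perm (Fin n)} (h : (vBasis n).repr (f.unop (v σ)) τ ≠ 0) : recoils τ ⊆ recoils σ :=
  recoils_subset_of_repr_ne_zero (unop_mem_antisymmetric hf (v_mem_antisymmetric σ)) h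

/-- The pairs indexing the matrix units that lie in `H n`. -/
abbrev UnitIndex (n : ℕ) : Type :=
  {p : Perm (Fin n) × Perm (Fin n) // recoils p.2 ⊆ recoils p.1}

/-- The span of the matrix units `v_σ ↦ v_τ` with `Rec τ ⊆ Rec σ`. -/
noncomputable def unitSpan (n : ℕ) : Submodule ℂ (Module.End ℂ (Space n))ᵐᵒᵖ :=
  Submodule.span ℂ (Set.range fun p : UnitIndex n => MulOpposite.op (matrixUnit p.1.1 p.1.2))

theorem H_le_unitSpan : (H n).toSubmodule ≤ unitSpan n := by
  intro f hf
  have h : f = ∑ σ, ∑ τ, (vBasis n).repr (f.unop (v σ)) τ • MulOpposite.op (matrixUnit σ τ) := by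
    apply MulOpposite.unop_injective
    simp only [Finset.unop_sum, MulOpposite.unop_smul, MulOpposite.unop_op]
    exact eq_sum_matrixUnit f.unop
  rw [h]
  refine sum_mem fun σ _ => sum_mem fun τ _ => ?_
  by_cases h0 : (vBasis n).repr (f.unop (v σ)) τ = 0
  · rw [h0, zero_smul]; exact zero_mem _
  · exact Submodule.smul_mem _ _ (Submodule.subset_span ⟨⟨(σ, τ), recoils_subset_of_mem hf h0⟩, rfl⟩)

theorem recoils_rev_mul_inv (σ : Perm (Fin n)) :
    recoils (Fin.revPerm * σ)⁻¹ = (descents σ)ᶜ := by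
  ext i
  rw [recoils_inv, Finset.mem_compl, mem_descents, mem_descents, Perm.mul_apply, Perm.mul_apply,
    Fin.revPerm_apply, Fin.revPerm_apply, Fin.rev_lt_rev, not_lt]
  exact ⟨le_of_lt, fun h => h.lt_of_ne fun h' => (lo_lt_hi i).ne (σ.injective h')⟩

/-- Left multiplication by the longest permutation complements the descent set; followed by
inversion, it turns disjointness into inclusion of recoil sets. -/
theorem card_unitIndex : Fintype.card (UnitIndex n) = Fintype.card
    {p : Perm (Fin n) × Perm (Fin n) // Disjoint (descents p.1) (recoils p.2)} := by
  have h : ∀ p : Perm (Fin n) × Perm (Fin n), Disjoint (descents p.1) (recoils p.2) ↔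
      recoils p.2 ⊆ recoils (Fin.revPerm * p.1)⁻¹ := fun p => by
    rw [recoils_rev_mul_inv, Finset.subset_compl_iff_disjoint_left]
  let e : Perm (Fin n) × Perm (Fin n) ≃ Perm (Fin n) × Perm (Fin n) :=
    Equiv.prodCongr ((Equiv.mulLeft Fin.revPerm).trans (Equiv.inv _)) (Equiv.refl _)
  exact Fintype.card_congr (Equiv.subtypeEquiv e h).symm

theorem H_eq_unitSpan : (H n).toSubmodule = unitSpan n := by
  refine Submodule.eq_of_le_of_finrank_le H_le_unitSpan ?_
  have h1 : Module.finrank ℂ (unitSpan n) ≤ Fintype.card (UnitIndex n) := finrank_range_le_card _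
  have h2 : LinearIndependent ℂ (fun p => (⟨_, op_sortOp_mem p⟩ : (H n).toSubmodule)) := by
    apply LinearIndependent.of_comp (H n).toSubmodule.subtype
    exact (sortOp_linearIndependent (n := n)).map'
      (MulOpposite.opLinearEquiv ℂ).toLinearMap (LinearEquiv.ker _)
  rw [card_unitIndex] at h1
  exact h1.trans h2.fintype_card_le_finrank

theorem op_matrixUnit_mem {σ τ : Perm (Fin n)} (h : recoils τ ⊆ recoils σ) :
    MulOpposite.op (matrixUnit σ τ) ∈ H n := by
  rw [← Subalgebra.mem_toSubmodule, H_eq_unitSpan]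
  exact Submodule.subset_span ⟨⟨(σ, τ), h⟩, rfl⟩

end MatrixUnits

end HSn

namespace HSn

/-! ### The corner on one representative per recoil set. -/

section Corner

variable {n : ℕ}

/-- The shortest permutation whose recoils are the complement of `A`. -/
noncomputable def rep (A : Finset (Fin (n - 1))) : Equiv.Perm (Fin n) := shortest Aᶜ

theorem recoils_rep (A : Finset (Fin (n - 1))) : recoils (rep A) = Aᶜ :=
  (Classical.choose_spec (exists_isShortest Aᶜ)).1

theorem rep_injective : Function.Injective (rep (n := n)) := fun A B h =>
  compl_injective (by rw [← recoils_rep, ← recoils_rep, h])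

/-- The endomorphism with the given coefficients on the vectors `v_σ`, `σ` among the
representatives, and killing the other `v_σ`. -/
noncomputable def repEnd (g : IncidenceAlgebra ℂ (Finset (Fin (n - 1)))) :
    Module.End ℂ (Space n) :=
  ∑ A, ∑ B, g A B • matrixUnit (rep A) (rep B)

theorem repEnd_apply (g : IncidenceAlgebra ℂ (Finset (Fin (n - 1)))) (x : Space n) :
    repEnd g x = ∑ A, (vBasis n).repr x (rep A) • ∑ B, g A B • v (rep B) := by
  simp only [repEnd, LinearMap.sum_apply, LinearMap.smul_apply, matrixUnit_apply, Finset.smul_sum]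
  exact Finset.sum_congr rfl fun A _ => Finset.sum_congr rfl fun B _ => smul_comm _ _ _

theorem repEnd_one_apply (x : Space n) :
    repEnd 1 x = ∑ A, (vBasis n).repr x (rep A) • v (rep A) := by
  rw [repEnd_apply]
  simp [IncidenceAlgebra.one_apply]

theorem repEnd_add (f g : IncidenceAlgebra ℂ (Finset (Fin (n - 1)))) :
    repEnd (f + g) = repEnd f + repEnd g := by
  simp only [repEnd, IncidenceAlgebra.add_apply, add_smul, Finset.sum_add_distrib]

theorem repEnd_smul (c : ℂ) (g : IncidenceAlgebra ℂ (Finset (Fin (n - 1)))) :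
    repEnd (c • g) = c • repEnd g := by
  simp only [repEnd, IncidenceAlgebra.constSMul_apply, smul_assoc, Finset.smul_sum]

theorem repr_sum_rep (c : Finset (Fin (n - 1)) → ℂ) (B : Finset (Fin (n - 1))) :
    (vBasis n).repr (∑ A, c A • v (rep A)) (rep B) = c B := by
  rw [map_sum, Finsupp.finsetSum_apply, Finset.sum_eq_single B]
  · simp [repr_v]
  · intro A _ hA
    simp [repr_v, Finsupp.single_eq_of_ne (fun h => hA (rep_injective h.symm))]
  · simp

theorem repr_repEnd (g : IncidenceAlgebra ℂ (Finset (Fin (n - 1)))) (x : Space n)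
    (B : Finset (Fin (n - 1))) :
    (vBasis n).repr (repEnd g x) (rep B) = ∑ A, (vBasis n).repr x (rep A) * g A B := by
  rw [repEnd_apply, map_sum, Finsupp.finsetSum_apply]
  refine Finset.sum_congr rfl fun A _ => ?_
  rw [map_smul, Finsupp.smul_apply, repr_sum_rep, smul_eq_mul]

theorem incidence_mul_apply (f g : IncidenceAlgebra ℂ (Finset (Fin (n - 1))))
    (A B : Finset (Fin (n - 1))) : (f * g) A B = ∑ C, f A C * g C B := by
  rw [IncidenceAlgebra.mul_apply]
  refine Finset.sum_subset (Finset.subset_univ _) fun C _ hC => ?_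
  rw [Finset.mem_Icc, not_and_or] at hC
  rcases hC with hC | hC
  · rw [IncidenceAlgebra.apply_eq_zero_of_not_le hC, zero_mul]
  · rw [IncidenceAlgebra.apply_eq_zero_of_not_le hC, mul_zero]

/-- Coefficients are indexed by (source, target), so composing endomorphisms reverses the incidence
product; the opposite algebra restores the order. -/
theorem repEnd_mul (f g : IncidenceAlgebra ℂ (Finset (Fin (n - 1)))) :
    repEnd (f * g) = repEnd g * repEnd f := by
  refine LinearMap.ext fun x => ?_
  rw [Module.End.mul_apply, repEnd_apply, repEnd_apply g]
  simp only [repr_repEnd, incidence_mul_apply, Finset.sum_smul]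
  rw [Finset.sum_comm]
  refine Finset.sum_congr rfl fun A _ => ?_
  rw [Finset.sum_comm]
  simp only [Finset.smul_sum, mul_smul]

theorem op_repEnd_mem (g : IncidenceAlgebra ℂ (Finset (Fin (n - 1)))) :
    MulOpposite.op (repEnd g) ∈ H n := by
  rw [repEnd, Finset.op_sum]
  refine sum_mem fun A _ => ?_
  rw [Finset.op_sum]
  refine sum_mem fun B _ => ?_
  rw [MulOpposite.op_smul]
  -- The complement in `rep` reverses inclusion: recoils shrink from `rep A` to `rep B` when A ⊆ B,
  -- matching the support of incidence functions.
  by_cases h : A ≤ B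
  · refine Subalgebra.smul_mem _ (op_matrixUnit_mem ?_) _
    rw [recoils_rep, recoils_rep]
    exact Finset.compl_subset_compl.2 h
  · rw [IncidenceAlgebra.apply_eq_zero_of_not_le h, zero_smul]
    exact zero_mem _

theorem op_repEnd_one :
    MulOpposite.op (repEnd 1) = ∑ I : Composition n, MulOpposite.op (pComp I) := by
  have h : repEnd 1 = ∑ S : Finset (Fin (n - 1)), proj (shortest S) := by
    rw [← Equiv.sum_comp (Function.Involutive.toPerm compl compl_involutive)]
    simp only [repEnd, IncidenceAlgebra.one_apply, ite_smul, one_smul, zero_smul,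
      Finset.sum_ite_eq, Finset.mem_univ, if_true]
    rfl
  rw [← Finset.op_sum, h,
    ← Equiv.sum_comp ((compositionEquiv n).trans (compositionAsSetEquiv n))]
  rfl

/-- The incidence algebra of the boolean lattice as a full corner of `H n`. -/
noncomputable def fullCorner (n : ℕ) :
    FullCorner ℂ (Equiv.Perm (Fin n)) (H n) (IncidenceAlgebra ℂ (Finset (Fin (n - 1)))) where
  emb :=
    { toFun := fun g => ⟨MulOpposite.op (repEnd g), op_repEnd_mem g⟩
      map_smul' := fun c g => Subtype.ext (congrArg MulOpposite.op (repEnd_smul c g))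
      map_zero' := Subtype.ext (congrArg MulOpposite.op (by simpa using repEnd_smul (n := n) 0 0))
      map_add' := fun f g => Subtype.ext (congrArg MulOpposite.op (repEnd_add f g))
      map_mul' := fun f g => Subtype.ext (congrArg MulOpposite.op (repEnd_mul f g)) }
  injective := fun f g h => by
    have h' : repEnd f = repEnd g := MulOpposite.op_injective (congrArg Subtype.val h)
    ext A B _
    have := congrArg (fun u => (vBasis n).repr (u (v (rep A))) (rep B)) h'
    simpa [repr_repEnd, repr_v, Finsupp.single_apply, rep_injective.eq_iff] using this
  exists_emb_eq := fun x => by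
    -- The matrix of x on the representatives; it is an incidence function because elements of `H n`
    -- can only shrink recoils.
    refine ⟨⟨fun A B => (vBasis n).repr (x.1.unop (v (rep A))) (rep B), fun A B hAB => ?_⟩, ?_⟩
    · by_contra h
      have := recoils_subset_of_mem x.2 h
      rw [recoils_rep, recoils_rep] at this
      exact hAB (Finset.compl_subset_compl.1 this)
    · apply Subtype.ext
      apply MulOpposite.unop_injective
      change repEnd _ = repEnd 1 * (x.1.unop * repEnd 1)
      refine LinearMap.ext fun y => ?_
      rw [Module.End.mul_apply, Module.End.mul_apply, repEnd_apply, repEnd_one_apply,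
        repEnd_one_apply, map_sum]
      simp only [map_sum, map_smul, Finsupp.finsetSum_apply, Finsupp.smul_apply, Finset.sum_smul,
        Finset.smul_sum, smul_assoc]
      exact Finset.sum_comm
  -- The path v_σ ↦ v_ρ ↦ v_σ, with ρ the representative having the recoils of σ, gives the diagonal
  -- unit at σ; these units add up to 1.
  left := fun σ => ⟨MulOpposite.op (matrixUnit σ (rep (recoils σ)ᶜ)),
    op_matrixUnit_mem (by rw [recoils_rep, compl_compl])⟩
  right := fun σ => ⟨MulOpposite.op (matrixUnit (rep (recoils σ)ᶜ) σ),
    op_matrixUnit_mem (by rw [recoils_rep, compl_compl])⟩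
  sum_eq_one := by
    apply Subtype.ext
    apply MulOpposite.unop_injective
    rw [AddSubmonoidClass.coe_finsetSum, Finset.unop_sum]
    change ∑ σ, matrixUnit (rep (recoils σ)ᶜ) σ * (repEnd 1 * matrixUnit σ (rep (recoils σ)ᶜ)) = 1
    refine LinearMap.ext fun x => ?_
    have h : ∀ A, repEnd 1 (v (rep A)) = (v (rep A) : Space n) := fun A => by
      simp [repEnd_one_apply, repr_v, Finsupp.single_apply, rep_injective.eq_iff]
    simp only [LinearMap.sum_apply, Module.End.mul_apply, matrixUnit_apply, map_smul, h, repr_v,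
      Finsupp.single_eq_same, one_smul, Module.End.one_apply]
    simpa only [vBasis_apply] using (vBasis n).sum_repr x

end Corner

end HSn

theorem theorem3p5 (n : ℕ) :
    (∃ (e : HSn.H n) (he : IsIdempotentElem e),
      (e : (Module.End ℂ (HSn.Space n))ᵐᵒᵖ) =
        ∑ I : Composition n, MulOpposite.op (HSn.pComp I) ∧
      Nonempty (he.Corner ≃ₐ[ℂ] IncidenceAlgebra ℂ (Finset (Fin (n - 1))))) ∧
    IsMoritaEquivalent ℂ (HSn.H n) (IncidenceAlgebra ℂ (Finset (Fin (n - 1)))) ∧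
    IsMoritaEquivalent ℂ (HSn.H n)ᵐᵒᵖ (IncidenceAlgebra ℂ (Finset (Fin (n - 1))))ᵐᵒᵖ := by
  let c := HSn.fullCorner n
  exact ⟨⟨c.emb 1, c.isIdempotentElem, HSn.op_repEnd_one, ⟨c.algEquivCorner _ rfl⟩⟩,
    c.isMoritaEquivalent, c.op.isMoritaEquivalent⟩
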